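/- Let $\mathbb{H}^3=\{(z,t): z\in\mathbb{C},\ t>0\}$ be hyperbolic $3$-space with its hyperbolic volume, on which $\mathrm{PSL}_2(\mathbb{C})$ acts by orientation-preserving isometries. Let $\Gamma$ be a Kleinian group of finite covolume, i.e. a discrete subgroup of $\mathrm{PSL}_2(\mathbb{C})$ whose action on $\mathbb{H}^3$ has a fundamental domain of finite hyperbolic volume. Let $\operatorname{tr}\Gamma\subset\mathbb{C}$ be the set of traces of all matrices in $\mathrm{SL}_2(\mathbb{C})$ whose image in $\mathrm{PSL}_2(\mathbb{C})$ lies in $\Gamma$, let $\mathbb{Q}(\operatorname{tr}\Gamma)\subset\mathbb{C}$ be the field it generates, and let $R$ be the ring of algebraic integers in $\mathbb{Q}(\operatorname{tr}\Gamma)$. Suppose that $\operatorname{tr}\Gamma\subset R$. If $A,B,X,Y\in\mathrm{PSL}_2(\mathbb{C})$ satisfy $\langle A,B\rangle=\Gamma=\langle X,Y\rangle$, then $\operatorname{tr}[A,B]-2$ and $\operatorname{tr}[X,Y]-2$ lie in $R$ and there is a unit $u\in R^{\times}$ with $$\operatorname{tr}[X,Y]-2=u\,(\operatorname{tr}[A,B]-2).$$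 Here $[A,B]=ABA^{-1}B^{-1}$, and $\operatorname{tr}[A,B]$ denotes the trace of the commutator of any lifts of $A,B$ to $\mathrm{SL}_2(\mathbb{C})$, which does not depend on the lifts (similarly for $X,Y$). -/

import Mathlib

open scoped MatrixGroups NumberField ComplexConjugate commutatorElement

noncomputable section

namespace Kleinian

/-- Hyperbolic 3-space in the upper half-space model: points `(z, t)` with `z ∈ ℂ`, `t > 0`. -/
def UpperHalfSpace : Type := {p : ℂ × ℝ // 0 < p.2}

namespace UpperHalfSpace

/-- The horizontal coordinate `z` of a point `(z, t)`. -/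
def z (p : UpperHalfSpace) : ℂ := p.1.1

/-- The height `t` of a point `(z, t)`. -/
def t (p : UpperHalfSpace) : ℝ := p.1.2

theorem t_pos (p : UpperHalfSpace) : 0 < p.t := p.2

theorem ext' {p q : UpperHalfSpace} (hz : p.z = q.z) (ht : p.t = q.t) : p = q :=
  Subtype.ext (Prod.ext hz ht)

/-- The Borel sigma-algebra, as a subspace of `ℂ × ℝ`. -/
instance : MeasurableSpace UpperHalfSpace :=
  inferInstanceAs (MeasurableSpace {p : ℂ × ℝ // 0 < p.2})

/-- The hyperbolic volume `dx dy dt / t ^ 3`, where `z = x + i y`. -/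
def hyperbolicVolume : MeasureTheory.Measure UpperHalfSpace :=
  (MeasureTheory.Measure.comap (fun p : UpperHalfSpace => ((p.z, p.t) : ℂ × ℝ))
    MeasureTheory.volume).withDensity (fun p => ENNReal.ofReal (1 / p.t ^ 3))

/-- The denominator `|c z + d|² + |c|² t²` of the action of `(a b; c d)` at `(z, t)`. -/
def denom (g : SL(2, ℂ)) (p : UpperHalfSpace) : ℝ :=
  Complex.normSq (g 1 0 * p.z + g 1 1) + Complex.normSq (g 1 0) * p.t ^ 2

/-- The numerator `(a z + b) conj (c z + d) + a conj c t²` of the first coordinate. -/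
def num (g : SL(2, ℂ)) (p : UpperHalfSpace) : ℂ :=
  (g 0 0 * p.z + g 0 1) * conj (g 1 0 * p.z + g 1 1) + g 0 0 * conj (g 1 0) * (p.t : ℂ) ^ 2

theorem det_eq (g : SL(2, ℂ)) : g 0 0 * g 1 1 - g 0 1 * g 1 0 = 1 := by
  have := g.det_coe
  rwa [Matrix.det_fin_two] at this

theorem denom_pos (g : SL(2, ℂ)) (p : UpperHalfSpace) : 0 < denom g p := by
  have ht := p.t_pos
  unfold denom
  by_cases hc : g 1 0 = 0
  · have hd : g 1 1 ≠ 0 := by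
      intro hd
      have := det_eq g
      simp [hc, hd] at this
    have := Complex.normSq_pos.2 hd
    simpa [hc] using this
  · have h1 := Complex.normSq_pos.2 hc
    have h2 := Complex.normSq_nonneg (g 1 0 * p.z + g 1 1)
    positivity

/-- The Poincare extension of the Moebius action of `SL(2, ℂ)`, by orientation-preserving
isometries of hyperbolic 3-space. -/
instance : SMul SL(2, ℂ) UpperHalfSpace where
  smul g p := ⟨(num g p / (denom g p : ℂ), p.t / denom g p), div_pos p.t_pos (denom_pos g p)⟩

theorem smul_z (g : SL(2, ℂ)) (p : UpperHalfSpace) : (g • p).z = num g p / (denom g p : ℂ) := rfl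

theorem smul_t (g : SL(2, ℂ)) (p : UpperHalfSpace) : (g • p).t = p.t / denom g p := rfl

theorem denom_coe (g : SL(2, ℂ)) (p : UpperHalfSpace) : (denom g p : ℂ) =
    (g 1 0 * p.z + g 1 1) * (conj (g 1 0) * conj p.z + conj (g 1 1))
      + g 1 0 * conj (g 1 0) * (p.t : ℂ) ^ 2 := by
  simp [denom, ← Complex.mul_conj]

theorem mul_entry (g h : SL(2, ℂ)) (i j : Fin 2) :
    (g * h) i j = g i 0 * h 0 j + g i 1 * h 1 j := by
  simp [Matrix.mul_apply, Fin.sum_univ_two]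

theorem conj_det_eq (g : SL(2, ℂ)) :
    conj (g 0 0) * conj (g 1 1) - conj (g 0 1) * conj (g 1 0) = 1 := by
  have := congrArg conj (det_eq g)
  simpa using this

theorem denom_mul (g h : SL(2, ℂ)) (p : UpperHalfSpace) :
    denom (g * h) p = denom g (h • p) * denom h p := by
  have hN : (denom h p : ℂ) ≠ 0 := by exact_mod_cast (denom_pos h p).ne'
  have hd := det_eq h
  have hd' := conj_det_eq h
  apply Complex.ofReal_injective
  rw [Complex.ofReal_mul, denom_coe g, denom_coe (g * h), smul_z, smul_t]
  simp only [map_div₀, Complex.conj_ofReal, Complex.ofReal_div, mul_entry]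
  field_simp
  rw [denom_coe h]
  simp only [num, map_add, map_mul, map_pow, Complex.conj_ofReal, Complex.conj_conj]
  generalize conj (h 0 0) = a' at *
  generalize conj (h 0 1) = b' at *
  generalize conj (h 1 0) = c' at *
  generalize conj (h 1 1) = d' at *
  generalize conj (g 1 0) = C' at *
  generalize conj (g 1 1) = D' at *
  generalize conj p.z = z' at *
  linear_combination (g 1 0 * C' * (p.t : ℂ) ^ 2) * (hd * (a' * d' - b' * c') + hd')

theorem num_mul (g h : SL(2, ℂ)) (p : UpperHalfSpace) :
    num (g * h) p = num g (h • p) * denom h p := by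
  have hN : (denom h p : ℂ) ≠ 0 := by exact_mod_cast (denom_pos h p).ne'
  have hd := det_eq h
  have hd' := conj_det_eq h
  rw [num, num, smul_z, smul_t]
  simp only [map_div₀, map_add, map_mul, Complex.conj_ofReal, Complex.ofReal_div, mul_entry]
  field_simp
  rw [denom_coe h]
  simp only [num, map_add, map_mul, map_pow, Complex.conj_ofReal, Complex.conj_conj]
  generalize conj (h 0 0) = a' at *
  generalize conj (h 0 1) = b' at *
  generalize conj (h 1 0) = c' at *
  generalize conj (h 1 1) = d' at *
  generalize conj (g 1 0) = C' at *
  generalize conj (g 1 1) = D' at *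
  generalize conj p.z = z' at *
  linear_combination (g 0 0 * C' * (p.t : ℂ) ^ 2) * (hd * (a' * d' - b' * c') + hd')

instance : MulAction SL(2, ℂ) UpperHalfSpace where
  one_smul p := by
    apply ext'
    · simp [smul_z, num, denom]
    · simp [smul_t, denom]
  mul_smul g h p := by
    have h1 : (denom h p : ℂ) ≠ 0 := by exact_mod_cast (denom_pos h p).ne'
    have h2 := (denom_pos h p).ne'
    apply ext'
    · rw [smul_z, smul_z g, num_mul, denom_mul, Complex.ofReal_mul, mul_div_mul_right _ _ h1]
    · rw [smul_t, smul_t g, smul_t h, denom_mul, div_div, mul_comm]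

theorem center_smul (g : SL(2, ℂ)) (hg : g ∈ Subgroup.center SL(2, ℂ)) (p : UpperHalfSpace) :
    g • p = p := by
  obtain ⟨r, hr, hrg⟩ := Matrix.SpecialLinearGroup.mem_center_iff.1 hg
  have h00 : g 0 0 = r := by rw [← hrg]; simp
  have h01 : g 0 1 = 0 := by rw [← hrg]; simp
  have h10 : g 1 0 = 0 := by rw [← hrg]; simp
  have h11 : g 1 1 = r := by rw [← hrg]; simp
  have hr2 : r * r = 1 := by simpa [pow_two] using hr
  have hn : Complex.normSq r = 1 := by
    rcases mul_self_eq_one_iff.1 hr2 with h | h <;> simp [h]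
  apply ext'
  · have hc : r * conj r = 1 := by rw [Complex.mul_conj, hn]; simp
    rw [smul_z, num, denom, h00, h01, h10, h11]
    simp only [zero_mul, zero_add, add_zero, map_zero, mul_zero, hn, Complex.ofReal_one, div_one]
    linear_combination p.z * hc
  · rw [smul_t, denom, h10, h11]
    simp [hn]

/-- The induced action of `PSL(2, ℂ)` on hyperbolic 3-space. -/
instance : MulAction PSL(2, ℂ) UpperHalfSpace :=
  MulAction.compHom UpperHalfSpace
    (QuotientGroup.lift (Subgroup.center SL(2, ℂ)) (MulAction.toPermHom SL(2, ℂ) UpperHalfSpace)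
      (fun g hg => Equiv.ext fun p => center_smul g hg p))

theorem mk_smul (g : SL(2, ℂ)) (p : UpperHalfSpace) : (g : PSL(2, ℂ)) • p = g • p := rfl

end UpperHalfSpace

/-- A Kleinian group is a discrete subgroup of `PSL(2, ℂ)` (with the quotient topology). -/
def IsKleinian (Γ : Subgroup PSL(2, ℂ)) : Prop := DiscreteTopology Γ

/-- `Γ` has finite covolume: its action on hyperbolic 3-space has a fundamental domain of finite
hyperbolic volume. -/
def HasFiniteCovolume (Γ : Subgroup PSL(2, ℂ)) : Prop :=
  ∃ s : Set UpperHalfSpace,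
    MeasureTheory.IsFundamentalDomain Γ s UpperHalfSpace.hyperbolicVolume ∧
      UpperHalfSpace.hyperbolicVolume s < ⊤

/-- The set `tr Γ`: traces of the elements of `Γ`, a trace in `PSL(2, ℂ)` being defined up to
sign, so that both signs occur. -/
def traceSet (Γ : Subgroup PSL(2, ℂ)) : Set ℂ :=
  {τ | ∃ g : SL(2, ℂ), (g : PSL(2, ℂ)) ∈ Γ ∧ (g : Matrix (Fin 2) (Fin 2) ℂ).trace = τ}

/-- The trace field `ℚ(tr Γ)`. -/
abbrev traceField (Γ : Subgroup PSL(2, ℂ)) : IntermediateField ℚ ℂ :=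
  IntermediateField.adjoin ℚ (traceSet Γ)

theorem commutator_mul_center (a b c d : SL(2, ℂ)) (hc : c ∈ Subgroup.center SL(2, ℂ))
    (hd : d ∈ Subgroup.center SL(2, ℂ)) : ⁅a * c, b * d⁆ = ⁅a, b⁆ := by
  rw [Subgroup.mem_center_iff] at hc hd
  have h1 : a * c * (b * d) = a * b * (c * d) := by
    rw [mul_assoc, ← mul_assoc c, ← hc b]; simp only [mul_assoc]
  have h2 : b * d * (a * c) = b * a * (c * d) := by
    rw [mul_assoc, ← mul_assoc d, ← hd a]; simp only [mul_assoc, hc d]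
  have e : ∀ x y : SL(2, ℂ), ⁅x, y⁆ = x * y * (y * x)⁻¹ := fun x y => by
    rw [commutatorElement_def]; group
  rw [e, e, h1, h2]; group

/-- `tr [A, B]` for `A, B ∈ PSL(2, ℂ)`, where `[A, B] = A B A⁻¹ B⁻¹`: the trace of the commutator
of any lifts of `A` and `B` to `SL(2, ℂ)`. -/
def commTrace (A B : PSL(2, ℂ)) : ℂ :=
  Quotient.liftOn₂' A B
    (fun a b : SL(2, ℂ) => ((⁅a, b⁆ : SL(2, ℂ)) : Matrix (Fin 2) (Fin 2) ℂ).trace)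
    (fun a b a' b' ha hb => by
      have ha' := QuotientGroup.leftRel_apply.1 ha
      have hb' := QuotientGroup.leftRel_apply.1 hb
      have := commutator_mul_center a b _ _ ha' hb'
      simp only [mul_inv_cancel_left] at this
      simp only [this])

theorem commTrace_mk (a b : SL(2, ℂ)) :
    commTrace (a : PSL(2, ℂ)) (b : PSL(2, ℂ)) =
      ((⁅a, b⁆ : SL(2, ℂ)) : Matrix (Fin 2) (Fin 2) ℂ).trace := rfl

end Kleinian

end

namespace Kleinian

open Matrix

/-! ### Traces of commutators as 4 × 4 determinants. -/

section CommRing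

variable {F : Type*} [CommRing F]

/-! The quantity `2 - tr [a, b]` is the determinant of the entries of `1, a, b, ab`
(`det_wordMatrix`). When `S` contains the traces of `a`, `b` and `ab`, Cayley–Hamilton makes the
`S`-span of these four matrices stable under left multiplication by `a`, `b` and their inverses, so
it contains every lift of every element of the group they generate (`lift_mem_wordSpan`). Hence `1,
x, y, xy` are `S`-combinations of `1, a, b, ab`, and taking determinants gives `tr [x, y] - 2 = s
(tr [a, b] - 2)` with `s` in `S`. If both pairs generate `Γ`, each difference divides the other in
the domain `R`, so they differ by a unit. -/

/-- The four matrices `1, a, b, a b`. -/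
def wordBasis (a b : Matrix (Fin 2) (Fin 2) F) : Fin 4 → Matrix (Fin 2) (Fin 2) F :=
  ![1, a, b, a * b]

/-- The entries of a `2 × 2` matrix, as a vector. -/
def entries (m : Matrix (Fin 2) (Fin 2) F) : Fin 4 → F :=
  ![m 0 0, m 0 1, m 1 0, m 1 1]

/-- The `4 × 4` matrix whose rows are the entries of `1, a, b, a b`. -/
def wordMatrix (a b : Matrix (Fin 2) (Fin 2) F) : Matrix (Fin 4) (Fin 4) F :=
  Matrix.of fun i => entries (wordBasis a b i)

theorem wordMatrix_zero (a b : Matrix (Fin 2) (Fin 2) F) : wordMatrix a b 0 = entries 1 := rfl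

theorem wordMatrix_one (a b : Matrix (Fin 2) (Fin 2) F) : wordMatrix a b 1 = entries a := rfl

theorem wordMatrix_two (a b : Matrix (Fin 2) (Fin 2) F) : wordMatrix a b 2 = entries b := rfl

theorem wordMatrix_three (a b : Matrix (Fin 2) (Fin 2) F) :
    wordMatrix a b 3 = entries (a * b) := rfl

theorem det_fin_four (M : Matrix (Fin 4) (Fin 4) F) : M.det =
    M 0 0 * !![M 1 1, M 1 2, M 1 3; M 2 1, M 2 2, M 2 3; M 3 1, M 3 2, M 3 3].det -
    M 0 1 * !![M 1 0, M 1 2, M 1 3; M 2 0, M 2 2, M 2 3; M 3 0, M 3 2, M 3 3].det +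
    M 0 2 * !![M 1 0, M 1 1, M 1 3; M 2 0, M 2 1, M 2 3; M 3 0, M 3 1, M 3 3].det -
    M 0 3 * !![M 1 0, M 1 1, M 1 2; M 2 0, M 2 1, M 2 2; M 3 0, M 3 1, M 3 2].det := by
  have e : ∀ j : Fin 4, M.submatrix Fin.succ j.succAbove =
      !![M 1 (j.succAbove 0), M 1 (j.succAbove 1), M 1 (j.succAbove 2);
        M 2 (j.succAbove 0), M 2 (j.succAbove 1), M 2 (j.succAbove 2);
        M 3 (j.succAbove 0), M 3 (j.succAbove 1), M 3 (j.succAbove 2)] := fun j => by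
    ext k l
    fin_cases k <;> fin_cases l <;> rfl
  rw [det_succ_row_zero, Fin.sum_univ_four, e, e, e, e]
  change (-1) ^ 0 * M 0 0 * !![M 1 1, M 1 2, M 1 3; M 2 1, M 2 2, M 2 3; M 3 1, M 3 2, M 3 3].det +
    (-1) ^ 1 * M 0 1 * !![M 1 0, M 1 2, M 1 3; M 2 0, M 2 2, M 2 3; M 3 0, M 3 2, M 3 3].det +
    (-1) ^ 2 * M 0 2 * !![M 1 0, M 1 1, M 1 3; M 2 0, M 2 1, M 2 3; M 3 0, M 3 1, M 3 3].det +
    (-1) ^ 3 * M 0 3 * !![M 1 0, M 1 1, M 1 2; M 2 0, M 2 1, M 2 2; M 3 0, M 3 1, M 3 2].det = _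
  ring

theorem det_wordMatrix (a b : SL(2, F)) :
    (wordMatrix (a : Matrix (Fin 2) (Fin 2) F) b).det =
      2 - ((⁅a, b⁆ : SL(2, F)) : Matrix (Fin 2) (Fin 2) F).trace := by
  have ha := a.det_coe
  have hb := b.det_coe
  rw [commutatorElement_def]
  simp only [Matrix.SpecialLinearGroup.coe_mul, Matrix.SpecialLinearGroup.coe_inv]
  generalize (a : Matrix (Fin 2) (Fin 2) F) = a at *
  generalize (b : Matrix (Fin 2) (Fin 2) F) = b at *
  -- Writing 2 as `2 * det a * det b`, with adjugates for inverses, makes both sides bihomogeneous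
  -- of degree (2, 2): the identity then holds for arbitrary matrices.
  have h2 : (2 : F) = 2 * a.det * b.det := by rw [ha, hb]; ring
  rw [h2, det_fin_four]
  simp only [wordMatrix_zero, wordMatrix_one, wordMatrix_two, wordMatrix_three, entries,
    trace_fin_two, adjugate_fin_two, mul_apply, det_fin_two, det_fin_three, Fin.sum_univ_two, of_apply, cons_val,
    one_apply_eq, one_apply_ne, ne_eq, zero_ne_one, one_ne_zero, not_false_eq_true]
  ring

/-! ### Stability of the span under the generated group. -/

/-- The `S`-module spanned by `1, a, b, a b`. -/
def wordSpan (S : Subring F) (a b : Matrix (Fin 2) (Fin 2) F) :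
    Submodule S (Matrix (Fin 2) (Fin 2) F) :=
  Submodule.span S (Set.range (wordBasis a b))

theorem wordBasis_mem (S : Subring F) (a b : Matrix (Fin 2) (Fin 2) F) (i : Fin 4) :
    wordBasis a b i ∈ wordSpan S a b :=
  Submodule.subset_span ⟨i, rfl⟩

theorem smul_mem_wordSpan {S : Subring F} {a b m : Matrix (Fin 2) (Fin 2) F} {s : F}
    (hs : s ∈ S) (hm : m ∈ wordSpan S a b) : s • m ∈ wordSpan S a b :=
  (wordSpan S a b).smul_mem ⟨s, hs⟩ hm

theorem mul_mem_wordSpan {S : Subring F} {a b c : Matrix (Fin 2) (Fin 2) F}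
    (h : ∀ i, c * wordBasis a b i ∈ wordSpan S a b) {m : Matrix (Fin 2) (Fin 2) F}
    (hm : m ∈ wordSpan S a b) : c * m ∈ wordSpan S a b := by
  induction hm using Submodule.span_induction with
  | mem x hx => obtain ⟨i, rfl⟩ := hx; exact h i
  | zero => simp
  | add x y _ _ hx hy => rw [mul_add]; exact add_mem hx hy
  | smul s x _ hx => rw [mul_smul_comm]; exact Submodule.smul_mem _ s hx

variable {S : Subring F} {a b : SL(2, F)}

theorem left_mul_mem_wordSpan (ha : (a : Matrix (Fin 2) (Fin 2) F).trace ∈ S)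
    {m : Matrix (Fin 2) (Fin 2) F} (hm : m ∈ wordSpan S (a : Matrix (Fin 2) (Fin 2) F) b) :
    (a : Matrix (Fin 2) (Fin 2) F) * m ∈ wordSpan S (a : Matrix (Fin 2) (Fin 2) F) b := by
  refine mul_mem_wordSpan (fun i => ?_) hm
  have hw := wordBasis_mem S (a : Matrix (Fin 2) (Fin 2) F) b
  have hd := a.det_coe
  generalize (a : Matrix (Fin 2) (Fin 2) F) = a at *
  generalize (b : Matrix (Fin 2) (Fin 2) F) = b at *
  -- Cayley–Hamilton with determinant 1.
  have hsq : a * a = a.trace • a - 1 := by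
    ext i j
    rw [det_fin_two] at hd
    fin_cases i <;> fin_cases j <;> simp [mul_apply, trace_fin_two] <;>
      first | ring1 | linear_combination -hd
  fin_cases i
  · simpa [wordBasis] using hw 1
  · simpa [wordBasis, hsq] using sub_mem (smul_mem_wordSpan ha (hw 1)) (hw 0)
  · simpa [wordBasis] using hw 3
  · simpa [wordBasis, ← mul_assoc, hsq, sub_mul] using
      sub_mem (smul_mem_wordSpan ha (hw 3)) (hw 2)

/-- The word "right" refers to the second generator `b`; the multiplication is still on the left.
Here `ba` and `bab` must be reordered, which is where the trace of `ab` enters. -/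
theorem right_mul_mem_wordSpan (ha : (a : Matrix (Fin 2) (Fin 2) F).trace ∈ S)
    (hb : (b : Matrix (Fin 2) (Fin 2) F).trace ∈ S)
    (hab : ((a : Matrix (Fin 2) (Fin 2) F) * b).trace ∈ S)
    {m : Matrix (Fin 2) (Fin 2) F} (hm : m ∈ wordSpan S (a : Matrix (Fin 2) (Fin 2) F) b) :
    (b : Matrix (Fin 2) (Fin 2) F) * m ∈ wordSpan S (a : Matrix (Fin 2) (Fin 2) F) b := by
  refine mul_mem_wordSpan (fun i => ?_) hm
  have hw := wordBasis_mem S (a : Matrix (Fin 2) (Fin 2) F) b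
  have hd := b.det_coe
  generalize (a : Matrix (Fin 2) (Fin 2) F) = a at *
  generalize (b : Matrix (Fin 2) (Fin 2) F) = b at *
  rw [det_fin_two] at hd
  have hsq : b * b = b.trace • b - 1 := by
    ext i j
    fin_cases i <;> fin_cases j <;> simp [mul_apply, trace_fin_two] <;>
      first | ring1 | linear_combination -hd
  -- Cayley–Hamilton, polarized.
  have hba : b * a = b.trace • a + a.trace • b + ((a * b).trace - a.trace * b.trace) • 1
      - a * b := by
    ext i j
    fin_cases i <;> fin_cases j <;> simp [mul_apply, trace_fin_two] <;> ring
  -- After substituting for `ba` and `b²`, the terms carrying the trace of `b` cancel.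
  have hbab : b * (a * b) = a + (a * b).trace • b - a.trace • 1 := by
    rw [← mul_assoc, hba]
    simp only [sub_mul, add_mul, smul_mul_assoc, one_mul, mul_assoc, hsq, mul_sub, mul_one,
      mul_smul_comm]
    module
  fin_cases i
  · simpa [wordBasis] using hw 2
  · have := sub_mem (add_mem (add_mem (smul_mem_wordSpan hb (hw 1)) (smul_mem_wordSpan ha (hw 2)))
      (smul_mem_wordSpan (sub_mem hab (mul_mem ha hb)) (hw 0))) (hw 3)
    change b * a ∈ _
    rw [hba]; exact this
  · simpa [wordBasis, hsq] using sub_mem (smul_mem_wordSpan hb (hw 2)) (hw 0)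
  · have := sub_mem (add_mem (hw 1) (smul_mem_wordSpan hab (hw 2))) (smul_mem_wordSpan ha (hw 0))
    change b * (a * b) ∈ _
    rw [hbab]; exact this

theorem coe_inv_eq_trace_sub (a : SL(2, F)) : ((a⁻¹ : SL(2, F)) : Matrix (Fin 2) (Fin 2) F) =
    (a : Matrix (Fin 2) (Fin 2) F).trace • 1 - (a : Matrix (Fin 2) (Fin 2) F) := by
  rw [Matrix.SpecialLinearGroup.coe_inv, adjugate_fin_two]
  ext i j
  fin_cases i <;> fin_cases j <;> simp [trace_fin_two]

/-- Words are built up from the left, starting at `1`; an inverse letter acts as `tr a - a`, so it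
needs no new coefficients. -/
theorem mem_wordSpan_of_mem_closure (ha : (a : Matrix (Fin 2) (Fin 2) F).trace ∈ S)
    (hb : (b : Matrix (Fin 2) (Fin 2) F).trace ∈ S)
    (hab : ((a : Matrix (Fin 2) (Fin 2) F) * b).trace ∈ S) {g : SL(2, F)}
    (hg : g ∈ Subgroup.closure {a, b}) :
    (g : Matrix (Fin 2) (Fin 2) F) ∈ wordSpan S (a : Matrix (Fin 2) (Fin 2) F) b := by
  induction hg using Subgroup.closure_induction_left with
  | one => simpa [wordBasis] using wordBasis_mem S (a : Matrix (Fin 2) (Fin 2) F) b 0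
  | mul_left x hx y _ hy =>
    rw [Matrix.SpecialLinearGroup.coe_mul]
    rcases hx with rfl | rfl
    · exact left_mul_mem_wordSpan ha hy
    · exact right_mul_mem_wordSpan ha hb hab hy
  | inv_mul_cancel x hx y _ hy =>
    rw [Matrix.SpecialLinearGroup.coe_mul, coe_inv_eq_trace_sub, sub_mul, smul_mul_assoc, one_mul]
    rcases hx with rfl | rfl
    · exact sub_mem (smul_mem_wordSpan ha hy) (left_mul_mem_wordSpan ha hy)
    · exact sub_mem (smul_mem_wordSpan hb hy) (right_mul_mem_wordSpan ha hb hab hy)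

/-- The factor is the determinant of the matrix of coefficients, whose entries lie in `S`. Linear
independence of `1, a, b, ab` is not needed. -/
theorem exists_det_wordMatrix_eq {a b x y : Matrix (Fin 2) (Fin 2) F}
    (h : ∀ i, wordBasis x y i ∈ wordSpan S a b) :
    ∃ s : S, (wordMatrix x y).det = s * (wordMatrix a b).det := by
  choose M hM using fun i => (Submodule.mem_span_range_iff_exists_fun S).1 (h i)
  let N : Matrix (Fin 4) (Fin 4) S := Matrix.of M
  have key : wordMatrix x y = N.map S.subtype * wordMatrix a b := by
    ext i j
    have e : ∀ k l, wordBasis x y i k l = ∑ n, (M i n : F) * wordBasis a b n k l := fun k l => by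
      rw [← hM i, Matrix.sum_apply]; rfl
    rw [mul_apply]
    fin_cases j <;> simpa [wordMatrix, entries, N] using e _ _
  refine ⟨N.det, ?_⟩
  rw [key, det_mul]
  exact congrArg (· * _) (S.subtype.map_det N).symm

end CommRing

/-! ### Passage to `PSL(2, ℂ)`. -/

/-- Lifts of elements of a two-generator subgroup of `PSL(2, ℂ)` lie in the module spanned by
`1, a, b, a b` over any ring containing the traces of `a`, `b` and `a b`. -/
theorem lift_mem_wordSpan {S : Subring ℂ} {a b g : SL(2, ℂ)}
    (ha : (a : Matrix (Fin 2) (Fin 2) ℂ).trace ∈ S)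
    (hb : (b : Matrix (Fin 2) (Fin 2) ℂ).trace ∈ S)
    (hab : ((a : Matrix (Fin 2) (Fin 2) ℂ) * b).trace ∈ S)
    (hg : (g : PSL(2, ℂ)) ∈ Subgroup.closure {(a : PSL(2, ℂ)), (b : PSL(2, ℂ))}) :
    (g : Matrix (Fin 2) (Fin 2) ℂ) ∈ wordSpan S (a : Matrix (Fin 2) (Fin 2) ℂ) b := by
  have himg : ({(a : PSL(2, ℂ)), (b : PSL(2, ℂ))} : Set PSL(2, ℂ)) =
      QuotientGroup.mk' (Subgroup.center SL(2, ℂ)) '' {a, b} := by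
    rw [Set.image_pair]; rfl
  rw [himg, ← MonoidHom.map_closure] at hg
  obtain ⟨w, hw, hwg⟩ := hg
  -- `w` is a word in `a, b` with the same image as `g`, so the two differ by a central scalar,
  -- which is ±1 and hence in `S`.
  have hc : w⁻¹ * g ∈ Subgroup.center SL(2, ℂ) := QuotientGroup.eq.1 hwg
  obtain ⟨r, hr, hrg⟩ := Matrix.SpecialLinearGroup.mem_center_iff.1 hc
  have hrS : r ∈ S := by
    have hr2 : r * r = 1 := by simpa [pow_two] using hr
    rcases mul_self_eq_one_iff.1 hr2 with rfl | rfl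
    · exact one_mem S
    · exact neg_mem (one_mem S)
  have hgw : (g : Matrix (Fin 2) (Fin 2) ℂ) = r • (w : Matrix (Fin 2) (Fin 2) ℂ) := by
    have : g = w * (w⁻¹ * g) := by group
    rw [this, Matrix.SpecialLinearGroup.coe_mul, ← hrg]
    ext i j
    simp [mul_comm]
  rw [hgw]
  exact smul_mem_wordSpan hrS (mem_wordSpan_of_mem_closure ha hb hab hw)

/-- One half of the divisibility: only `A, B` have to generate, so the lemma can be applied again
with the pairs exchanged. -/
theorem exists_commTrace_sub_two_eq_mul {Γ : Subgroup PSL(2, ℂ)} {S : Subring ℂ}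
    (hS : ∀ τ ∈ traceSet Γ, τ ∈ S) {A B X Y : PSL(2, ℂ)}
    (hAB : Subgroup.closure {A, B} = Γ) (hX : X ∈ Γ) (hY : Y ∈ Γ) :
    ∃ s : S, commTrace X Y - 2 = s * (commTrace A B - 2) := by
  obtain ⟨a, rfl⟩ := QuotientGroup.mk_surjective A
  obtain ⟨b, rfl⟩ := QuotientGroup.mk_surjective B
  obtain ⟨x, rfl⟩ := QuotientGroup.mk_surjective X
  obtain ⟨y, rfl⟩ := QuotientGroup.mk_surjective Y
  have hA : (a : PSL(2, ℂ)) ∈ Γ := hAB ▸ Subgroup.subset_closure (by simp)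
  have hB : (b : PSL(2, ℂ)) ∈ Γ := hAB ▸ Subgroup.subset_closure (by simp)
  have hspan : ∀ g : SL(2, ℂ), (g : PSL(2, ℂ)) ∈ Γ →
      (g : Matrix (Fin 2) (Fin 2) ℂ) ∈ wordSpan S (a : Matrix (Fin 2) (Fin 2) ℂ) b := fun g hg =>
    lift_mem_wordSpan (hS _ ⟨a, hA, rfl⟩) (hS _ ⟨b, hB, rfl⟩)
      (hS _ ⟨a * b, mul_mem hA hB, by rw [Matrix.SpecialLinearGroup.coe_mul]⟩) (hAB ▸ hg)
  obtain ⟨s, hs⟩ := exists_det_wordMatrix_eq (S := S) (a := (a : Matrix (Fin 2) (Fin 2) ℂ)) (b := b)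
    (x := x) (y := y) (fun i => by
      fin_cases i
      · simpa [wordBasis] using hspan 1 (one_mem Γ)
      · exact hspan x hX
      · exact hspan y hY
      · simpa [wordBasis] using hspan (x * y) (mul_mem hX hY))
  rw [det_wordMatrix, det_wordMatrix] at hs
  refine ⟨s, ?_⟩
  rw [commTrace_mk, commTrace_mk]
  linear_combination -hs

theorem commTrace_mem_traceSet {Γ : Subgroup PSL(2, ℂ)} {A B : PSL(2, ℂ)} (hA : A ∈ Γ)
    (hB : B ∈ Γ) : commTrace A B ∈ traceSet Γ := by
  obtain ⟨a, rfl⟩ := QuotientGroup.mk_surjective A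
  obtain ⟨b, rfl⟩ := QuotientGroup.mk_surjective B
  exact ⟨⁅a, b⁆, mul_mem (mul_mem (mul_mem hA hB) (inv_mem hA)) (inv_mem hB), rfl⟩

end Kleinian

theorem mainTheorem9 (Γ : Subgroup PSL(2, ℂ))
    (hΓ : Kleinian.IsKleinian Γ) (hcov : Kleinian.HasFiniteCovolume Γ)
    (hint : ∀ τ ∈ Kleinian.traceSet Γ,
      ∃ r : 𝓞 (Kleinian.traceField Γ), ((r : Kleinian.traceField Γ) : ℂ) = τ)
    (A B X Y : PSL(2, ℂ))
    (hAB : Subgroup.closure {A, B} = Γ) (hXY : Subgroup.closure {X, Y} = Γ) :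
    ∃ α ξ : 𝓞 (Kleinian.traceField Γ),
      ((α : Kleinian.traceField Γ) : ℂ) = Kleinian.commTrace A B - 2 ∧
      ((ξ : Kleinian.traceField Γ) : ℂ) = Kleinian.commTrace X Y - 2 ∧
      ∃ u : (𝓞 (Kleinian.traceField Γ))ˣ, ξ = (u : 𝓞 (Kleinian.traceField Γ)) * α := by
  let K := Kleinian.traceField Γ
  -- The range of `φ` is `R` viewed as a subring of `ℂ`; injectivity of `φ` brings the relations
  -- back to `𝓞 K`.
  let φ : 𝓞 K →+* ℂ := (algebraMap K ℂ).comp (algebraMap (𝓞 K) K)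
  have hφ : Function.Injective φ :=
    (algebraMap K ℂ).injective.comp (FaithfulSMul.algebraMap_injective (𝓞 K) K)
  have hS : ∀ τ ∈ Kleinian.traceSet Γ, τ ∈ φ.range := fun τ hτ => by
    obtain ⟨r, hr⟩ := hint τ hτ
    exact ⟨r, hr⟩
  have hA : A ∈ Γ := hAB ▸ Subgroup.subset_closure (by simp)
  have hB : B ∈ Γ := hAB ▸ Subgroup.subset_closure (by simp)
  have hX : X ∈ Γ := hXY ▸ Subgroup.subset_closure (by simp)
  have hY : Y ∈ Γ := hXY ▸ Subgroup.subset_closure (by simp)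
  obtain ⟨α, hα⟩ := hS _ (Kleinian.commTrace_mem_traceSet hA hB)
  obtain ⟨ξ, hξ⟩ := hS _ (Kleinian.commTrace_mem_traceSet hX hY)
  obtain ⟨⟨_, s, rfl⟩, hs⟩ := Kleinian.exists_commTrace_sub_two_eq_mul hS hAB hX hY
  obtain ⟨⟨_, t, rfl⟩, ht⟩ := Kleinian.exists_commTrace_sub_two_eq_mul hS hXY hA hB
  have hα' : φ (α - 2) = Kleinian.commTrace A B - 2 := by rw [map_sub, hα, map_ofNat]
  have hξ' : φ (ξ - 2) = Kleinian.commTrace X Y - 2 := by rw [map_sub, hξ, map_ofNat]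
  have h1 : ξ - 2 = s * (α - 2) := hφ (by rw [map_mul, hα', hξ']; exact hs)
  have h2 : α - 2 = t * (ξ - 2) := hφ (by rw [map_mul, hα', hξ']; exact ht)
  -- Mutual divisibility in a domain gives associates, also when both elements vanish.
  obtain ⟨u, hu⟩ := associated_of_dvd_dvd (Dvd.intro_left s h1.symm) (Dvd.intro_left t h2.symm)
  exact ⟨α - 2, ξ - 2, hα', hξ', u, by rw [← hu, mul_comm]⟩
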